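/- Let $D\subset\mathbb R^2$ be a compact, connected and simply connected planar domain bounded by a smooth simple closed curve $\gamma$, where $\gamma(t)$ is parameterized by arc length and oriented as the boundary of $D$. Let $n(t)$ be the inward unit normal along $\gamma$ and $k(t)$ the signed curvature of $\gamma$, so that $\gamma''=k\,n$. Let $H$ be a real-valued $C^\infty$ function defined on a neighborhood of $D$ which is constant on $\gamma=\partial D$; write $H(t,s)=H(\gamma(t)+s\,n(t))$ near $\gamma$. Suppose that the solutions in $D$ of the system $$H_{xx}=H_{yy},\qquad H_{xy}=0 \qquad (*)$$ are isolated and that none of them lies on $\partial D$. Suppose moreover that one of the following conditions holds: (i) $H_{ss}(t,0)+k(t)H_s(t,0)\neq 0$ for all $t$; (ii) $H_s(t,0)=0$ for all $t$, i.e. $H$ has zero normal derivative along $\gamma$. Then $(*)$ has two solutions in the interior of $D$, counted with multiplicity. Here the solutions of $(*)$ are the zeros of the vector field $V=(H_{yy}-H_{xx})\,\partial_x-2H_{xy}\,\partial_y$, the multiplicity of a solution is the index of $V$ at it (the rotation number of $V$ along every sufficiently small counterclockwise circle around it), and the claim is that $(*)$ has only finitely many solutions in the interior of $D$ and that the sum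 of their multiplicities equals $2$. -/

import Mathlib

open Set Filter Topology
open scoped ContDiff

namespace ConformalPoints

/-! The Euclidean plane is modelled by `ℂ`, with coordinates `z = x + i y`; all derivatives
are real derivatives. -/

noncomputable section

/-- The partial derivative `F_x`. -/
def partialX (F : ℂ → ℝ) (z : ℂ) : ℝ := fderiv ℝ F z 1

/-- The partial derivative `F_y`. -/
def partialY (F : ℂ → ℝ) (z : ℂ) : ℝ := fderiv ℝ F z Complex.I

/-- The second derivative `H_xx`. -/
def Hxx (H : ℂ → ℝ) : ℂ → ℝ := partialX (partialX H)

/-- The mixed second derivative `H_xy`. -/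
def Hxy (H : ℂ → ℝ) : ℂ → ℝ := partialY (partialX H)

/-- The second derivative `H_yy`. -/
def Hyy (H : ℂ → ℝ) : ℂ → ℝ := partialY (partialY H)

/-- `z` solves the system `H_xx = H_yy`, `H_xy = 0`. -/
def IsSolution (H : ℂ → ℝ) (z : ℂ) : Prop := Hxx H z = Hyy H z ∧ Hxy H z = 0

/-- The vector field `V = (H_yy - H_xx) ∂_x - 2 H_xy ∂_y`. Its zeros are the solutions of the
system. -/
def V (H : ℂ → ℝ) (z : ℂ) : ℂ := ⟨Hyy H z - Hxx H z, -2 * Hxy H z⟩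

/-- The loop `f`, parameterized by `[0, 1]`, vanishes nowhere and makes `m` full turns around the
origin: `f = |f| exp (2 π i θ)` with a continuous `θ` that increases by `m`. -/
def HasRotationNumber (f : ℝ → ℂ) (m : ℤ) : Prop :=
  (∀ t ∈ Icc (0 : ℝ) 1, f t ≠ 0) ∧
  ∃ θ : ℝ → ℝ, ContinuousOn θ (Icc 0 1) ∧
    (∀ t ∈ Icc (0 : ℝ) 1, f t = ‖f t‖ * Complex.exp (2 * Real.pi * θ t * Complex.I)) ∧
    θ 1 - θ 0 = m

/-- The index of the planar vector field `W` at `z` is `m`: along every sufficiently small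
circle around `z`, run through once counterclockwise, `W` has rotation number `m`. -/
def HasIndex (W : ℂ → ℂ) (z : ℂ) (m : ℤ) : Prop :=
  ∀ᶠ r : ℝ in 𝓝[>] 0,
    HasRotationNumber (fun t : ℝ => W (z + r * Complex.exp (2 * Real.pi * t * Complex.I))) m

/-- The unit normal `n` of a unit speed curve: the unit tangent turned by `π / 2`
counterclockwise. -/
def normal (γ : ℝ → ℂ) (t : ℝ) : ℂ := Complex.I * deriv γ t

/-- The signed curvature `k` of a unit speed curve, characterized by `γ'' = k n`; it is the
component of `γ''` along `n`. -/
def curvature (γ : ℝ → ℂ) (t : ℝ) : ℝ := inner ℝ (normal γ t) (iteratedDeriv 2 γ t)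

/-- The function `s ↦ H (t, s)`: the restriction of `H` to the normal line at `γ t`. -/
def alongNormal (H : ℂ → ℝ) (γ : ℝ → ℂ) (t s : ℝ) : ℝ := H (γ t + s * normal γ t)

/-- The normal derivative `H_s (t, 0)`. -/
def Hs (H : ℂ → ℝ) (γ : ℝ → ℂ) (t : ℝ) : ℝ := deriv (alongNormal H γ t) 0

/-- The second normal derivative `H_ss (t, 0)`. -/
def Hss (H : ℂ → ℝ) (γ : ℝ → ℂ) (t : ℝ) : ℝ := iteratedDeriv 2 (alongNormal H γ t) 0

/-- `D` is a (closed) connected and simply connected planar domain bounded by the smooth simple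
closed curve `γ` of length `L`, parameterized by arc length and oriented as the boundary of `D`,
that is, so that the normal `n` points into `D`. -/
structure IsSmoothDomain (D : Set ℂ) (γ : ℝ → ℂ) (L : ℝ) : Prop where
  isCompact : IsCompact D
  isSimplyConnected : IsSimplyConnected D
  length_pos : 0 < L
  contDiff : ContDiff ℝ ∞ γ
  periodic : Function.Periodic γ L
  injOn : InjOn γ (Ico 0 L)
  unit_speed : ∀ t, ‖deriv γ t‖ = 1
  range_eq : range γ = frontier D
  inward : ∀ t, ∀ᶠ s : ℝ in 𝓝[>] 0, γ t + s * normal γ t ∈ interior D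

end

/-- The rotation number is unique. -/
theorem HasRotationNumber.unique {f : ℝ → ℂ} {m n : ℤ}
    (hm : HasRotationNumber f m) (hn : HasRotationNumber f n) : m = n := by
  obtain ⟨h0, θ, hθ, hfθ, hθm⟩ := hm
  obtain ⟨-, φ, hφ, hfφ, hφn⟩ := hn
  have key : ∀ t ∈ Icc (0 : ℝ) 1, ∃ k : ℤ, θ t - φ t = k := by
    intro t ht
    have h1 := hfθ t ht
    have h2 := (hfφ t ht)
    have hne : (‖f t‖ : ℂ) ≠ 0 := by simpa using h0 t ht
    have h3 : Complex.exp (2 * Real.pi * θ t * Complex.I)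
        = Complex.exp (2 * Real.pi * φ t * Complex.I) :=
      mul_left_cancel₀ hne (h1.symm.trans h2)
    obtain ⟨k, hk⟩ := Complex.exp_eq_exp_iff_exists_int.1 h3
    refine ⟨k, ?_⟩
    have hpi : (2 * Real.pi * Complex.I : ℂ) ≠ 0 := Complex.two_pi_I_ne_zero
    have h4 : ((θ t : ℂ)) = φ t + k := by
      apply mul_left_cancel₀ hpi
      linear_combination hk
    have h5 : θ t = φ t + k := by exact_mod_cast h4
    linarith
  have hc : ContinuousOn (fun t => θ t - φ t) (Icc 0 1) := hθ.sub hφ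
  have hsub : ((fun t => θ t - φ t) '' Icc 0 1).Subsingleton := by
    refine (Set.countable_range (fun k : ℤ => (k : ℝ))).isTotallyDisconnected _ ?_
      (isPreconnected_Icc.image _ hc)
    rintro _ ⟨t, ht, rfl⟩
    obtain ⟨k, hk⟩ := key t ht
    exact ⟨k, hk.symm⟩
  have h01 := hsub (mem_image_of_mem _ (left_mem_Icc.2 zero_le_one))
    (mem_image_of_mem _ (right_mem_Icc.2 zero_le_one))
  have : (m : ℝ) = n := by linarith
  exact_mod_cast this

/-- The index is unique. -/
theorem HasIndex.unique {W : ℂ → ℂ} {z : ℂ} {m n : ℤ}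
    (hm : HasIndex W z m) (hn : HasIndex W z n) : m = n := by
  obtain ⟨r, h1, h2⟩ := (hm.and hn).exists
  exact h1.unique h2

end ConformalPoints

/-!
Along the boundary, write `V = h * γ' ^ 2`. Since `H` is constant on `γ`, the Frenet equation gives
`Re h = H_ss + k H_s` (`re_V_mul_conj_deriv_sq`). If `H_s` vanishes identically, so does the gradient
along `γ`, the only possibly nonzero entry of the Hessian in the frame `(γ', n)` is `H_ss`, and
`H_ss ≠ 0` because no solution lies on the boundary (`Hss_ne_zero_of_Hs_eq_zero`). So in both cases
`Re h` has no zeros, and `V` turns along `γ` as often as `γ' ^ 2`.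

Next, `γ'` turns along `γ` as often as `γ - z₀` for some interior point `z₀`
(`IsSmoothDomain.hasRotationNumber_deriv_div`). Let `q = γ + s n` be a parallel curve inside `D`, and
let `γ` start at a lowest point of `D`. A logarithm of `γ t - q τ` in the two variables `t`, `τ`
compares the diagonal `t = τ`, where the function is `-s i γ'`, with the sides `τ = 0`, where it is
`γ - z₀` for `z₀ = q 0`, and `t = 1`, where it stays in a half plane and does not turn.

So `V / (γ - z₀) ^ 2` has rotation number `0` along `γ`, hence a logarithm on `γ`, which by Tietze's
theorem extends to a continuous `G` on the plane. The function equal to `V` on `D` and to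
`exp G * (z - z₀) ^ 2` outside is continuous on the plane, has the same zeros as `V` in `D`, and
turns twice along large circles (`sum_index_eq_of_hasRotationNumber`). By the degree formula in the
plane (`hasRotationNumber_circleLoop_eq_sum`), proved by removing the zeros one at a time, the
indices add up to `2`. Neither the Jordan curve theorem nor the value of the turning number of `γ`
is needed.
-/

namespace ConformalPoints

/-! ### Continuous logarithms and rotation numbers -/

theorem exists_continuous_log {X : Type*} [TopologicalSpace X] [SimplyConnectedSpace X]
    [LocallyPathConnectedSpace X] {f : X → ℂ} (hf : Continuous f) (h0 : ∀ x, f x ≠ 0) :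
    ∃ g : X → ℂ, Continuous g ∧ ∀ x, Complex.exp (g x) = f x := by
  obtain ⟨x₀⟩ : Nonempty X := inferInstance
  obtain ⟨g, ⟨-, hg⟩, -⟩ := Complex.isCoveringMapOn_exp.existsUnique_continuousMap_lifts
    ⟨f, hf⟩ (Complex.exp_log (h0 x₀)) (fun x => h0 x)
  exact ⟨g, g.continuous, fun x => congrFun hg x⟩

/-- Two continuous logarithms of the same function on a connected space differ by a constant. -/
theorem sub_eq_sub_of_exp_eq {X : Type*} [TopologicalSpace X] [PreconnectedSpace X]
    {u v : X → ℂ} (hu : Continuous u) (hv : Continuous v)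
    (h : ∀ x, Complex.exp (u x) = Complex.exp (v x)) (x y : X) : u x - v x = u y - v y := by
  have hsub : (range fun x => u x - v x).Subsingleton := by
    refine (Set.countable_range
      (fun k : ℤ => (k : ℂ) * (2 * Real.pi * Complex.I))).isTotallyDisconnected _ ?_
      (isPreconnected_range (hu.sub hv))
    rintro _ ⟨x, rfl⟩
    obtain ⟨k, hk⟩ := Complex.exp_eq_exp_iff_exists_int.1 (h x)
    exact ⟨k, by simp [hk]⟩
  exact hsub (mem_range_self x) (mem_range_self y)

theorem hasRotationNumber_of_log {f ℓ : ℝ → ℂ} {m : ℤ} (hℓ : Continuous ℓ)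
    (h : ∀ t, Complex.exp (ℓ t) = f t) (hm : ℓ 1 - ℓ 0 = 2 * Real.pi * Complex.I * m) :
    HasRotationNumber f m := by
  refine ⟨fun t _ => h t ▸ Complex.exp_ne_zero _, fun t => (ℓ t).im / (2 * Real.pi),
    by fun_prop, fun t _ => ?_, ?_⟩
  · rw [← h t, Complex.norm_exp, Complex.ofReal_exp, ← Complex.exp_add]
    congr 1
    have : (Real.pi : ℂ) ≠ 0 := by exact_mod_cast Real.pi_ne_zero
    push_cast
    field_simp
    exact (Complex.re_add_im _).symm
  · have h2 := congrArg Complex.im hm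
    have : ((m : ℂ)) = ((m : ℝ) : ℂ) := by simp
    rw [this] at h2
    simp at h2
    field_simp [Real.pi_ne_zero]
    linarith

theorem exists_log_sub_eq {ℓ : ℝ → ℂ} (h : Complex.exp (ℓ 0) = Complex.exp (ℓ 1)) :
    ∃ m : ℤ, ℓ 1 - ℓ 0 = 2 * Real.pi * Complex.I * m := by
  obtain ⟨k, hk⟩ := Complex.exp_eq_exp_iff_exists_int.1 h.symm
  exact ⟨k, by rw [hk]; ring⟩

/-- A loop of rotation number `0` has a logarithm that is itself a loop. -/
theorem HasRotationNumber.exists_log_loop {f : ℝ → ℂ} (hf : Continuous f) (h0 : ∀ t, f t ≠ 0)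
    (h01 : f 0 = f 1) (hm : HasRotationNumber f 0) :
    ∃ ℓ : ℝ → ℂ, Continuous ℓ ∧ (∀ t, Complex.exp (ℓ t) = f t) ∧ ℓ 0 = ℓ 1 := by
  obtain ⟨ℓ, hℓ, h⟩ := exists_continuous_log hf h0
  obtain ⟨k, hk⟩ := exists_log_sub_eq (ℓ := ℓ) (by rw [h, h, h01])
  have hk0 : k = 0 := (hasRotationNumber_of_log hℓ h hk).unique hm
  refine ⟨ℓ, hℓ, h, ?_⟩
  rw [hk0] at hk
  simp only [Int.cast_zero, mul_zero, sub_eq_zero] at hk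
  exact hk.symm

theorem HasRotationNumber.mul {f g : ℝ → ℂ} {m n : ℤ} (hf : HasRotationNumber f m)
    (hg : HasRotationNumber g n) : HasRotationNumber (fun t => f t * g t) (m + n) := by
  obtain ⟨h0, θ, hθ, hfθ, hθm⟩ := hf
  obtain ⟨k0, φ, hφ, hgφ, hφn⟩ := hg
  refine ⟨fun t ht => mul_ne_zero (h0 t ht) (k0 t ht), fun t => θ t + φ t, hθ.add hφ,
    fun t ht => ?_, by push_cast; linarith⟩
  conv_lhs => beta_reduce; rw [hfθ t ht, hgφ t ht]
  rw [norm_mul, mul_mul_mul_comm, ← Complex.exp_add]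
  push_cast
  congr 2
  ring

theorem HasRotationNumber.zpow {f : ℝ → ℂ} {m : ℤ} (hf : HasRotationNumber f m) (k : ℤ) :
    HasRotationNumber (fun t => f t ^ k) (k * m) := by
  obtain ⟨h0, θ, hθ, hfθ, hθm⟩ := hf
  refine ⟨fun t ht => zpow_ne_zero _ (h0 t ht), fun t => k * θ t, continuousOn_const.mul hθ,
    fun t ht => ?_, by push_cast; rw [← hθm]; ring⟩
  conv_lhs => beta_reduce; rw [hfθ t ht]
  rw [norm_zpow, mul_zpow, ← Complex.exp_int_mul]
  push_cast
  congr 2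
  ring

theorem HasRotationNumber.congr {f g : ℝ → ℂ} {m : ℤ} (hf : HasRotationNumber f m)
    (h : ∀ t, g t = f t) : HasRotationNumber g m := by
  rwa [funext h]

theorem hasRotationNumber_zero_of_mem_slitPlane {f : ℝ → ℂ} (hf : Continuous f)
    (h : ∀ t, f t ∈ Complex.slitPlane) (h01 : f 0 = f 1) : HasRotationNumber f 0 :=
  hasRotationNumber_of_log (ℓ := fun t => Complex.log (f t)) (hf.clog h)
    (fun t => Complex.exp_log (Complex.slitPlane_ne_zero (h t))) (by simp [h01])

theorem hasRotationNumber_const {c : ℂ} (hc : c ≠ 0) : HasRotationNumber (fun _ => c) 0 :=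
  hasRotationNumber_of_log (ℓ := fun _ => Complex.log c) continuous_const
    (fun _ => Complex.exp_log hc) (by simp)

/-! ### Circles -/

/-- The circle of radius `r` around `a`, run through once counterclockwise by `t ∈ [0, 1]`. -/
noncomputable def circleLoop (a : ℂ) (r t : ℝ) : ℂ :=
  a + r * Complex.exp (2 * Real.pi * t * Complex.I)

@[fun_prop]
theorem continuous_circleLoop (a : ℂ) (r : ℝ) : Continuous (circleLoop a r) := by
  unfold circleLoop; fun_prop

theorem circleLoop_zero_eq_one (a : ℂ) (r : ℝ) : circleLoop a r 0 = circleLoop a r 1 := by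
  simp [circleLoop, Complex.exp_two_pi_mul_I]

theorem norm_exp_two_pi_mul (t : ℝ) : ‖Complex.exp (2 * Real.pi * t * Complex.I)‖ = 1 := by
  rw [← Complex.norm_exp_ofReal_mul_I (2 * Real.pi * t)]; push_cast; rfl

theorem norm_circleLoop_sub {r : ℝ} (hr : 0 ≤ r) (a : ℂ) (t : ℝ) : ‖circleLoop a r t - a‖ = r := by
  simp [circleLoop, norm_exp_two_pi_mul, abs_of_nonneg hr]

theorem injOn_circleLoop (a : ℂ) {r : ℝ} (hr : 0 < r) : InjOn (circleLoop a r) (Ico 0 1) := by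
  intro s hs t ht h
  have hr' : (r : ℂ) ≠ 0 := by exact_mod_cast hr.ne'
  have h1 := mul_left_cancel₀ hr' (add_left_cancel h)
  obtain ⟨k, hk⟩ := Complex.exp_eq_exp_iff_exists_int.1 h1
  have h2 : (s : ℂ) = t + k := by
    apply mul_left_cancel₀ Complex.two_pi_I_ne_zero
    linear_combination hk
  have h3 : s = t + k := by exact_mod_cast h2
  have h4 : (k : ℝ) < 1 := by linarith [hs.2, ht.1]
  have h5 : (-1 : ℝ) < k := by linarith [hs.1, ht.2]
  have h6 : k = 0 := by
    have : k < 1 := by exact_mod_cast h4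
    have : -1 < k := by exact_mod_cast h5
    omega
  simpa [h6] using h3

theorem exists_circleLoop_eq {a z : ℂ} {r : ℝ} (hz : ‖z - a‖ = r) :
    ∃ t ∈ Icc (0 : ℝ) 1, circleLoop a r t = z := by
  have h1 : ∀ k : ℤ, circleLoop a r ((z - a).arg / (2 * Real.pi) + k) = z := by
    intro k
    have hpi : (Real.pi : ℂ) ≠ 0 := by exact_mod_cast Real.pi_ne_zero
    have : 2 * Real.pi * (((z - a).arg / (2 * Real.pi) + k : ℝ) : ℂ) * Complex.I
        = (z - a).arg * Complex.I + k * (2 * Real.pi * Complex.I) := by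
      push_cast; field_simp
    rw [circleLoop, this, Complex.exp_add, Complex.exp_int_mul_two_pi_mul_I, mul_one, ← hz,
      Complex.norm_mul_exp_arg_mul_I]
    ring
  refine ⟨Int.fract ((z - a).arg / (2 * Real.pi)), ⟨Int.fract_nonneg _, (Int.fract_lt_one _).le⟩, ?_⟩
  have := h1 (-⌊(z - a).arg / (2 * Real.pi)⌋)
  rwa [Int.cast_neg, ← sub_eq_add_neg] at this

theorem hasRotationNumber_circleLoop_sub_of_lt {a b : ℂ} {r : ℝ} (h : ‖a - b‖ < r) :
    HasRotationNumber (fun t => circleLoop a r t - b) 1 := by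
  have hr : 0 < r := (norm_nonneg _).trans_lt h
  have hr' : (r : ℂ) ≠ 0 := by exact_mod_cast hr.ne'
  have h1 : HasRotationNumber (fun t : ℝ => (r : ℂ) * Complex.exp (2 * Real.pi * t * Complex.I)) 1 :=
    hasRotationNumber_of_log
      (ℓ := fun t : ℝ => Complex.log r + 2 * Real.pi * t * Complex.I) (by fun_prop)
      (fun t => by rw [Complex.exp_add, Complex.exp_log hr']) (by simp)
  have h2 : HasRotationNumber (fun t : ℝ =>
      1 + (a - b) / (r * Complex.exp (2 * Real.pi * t * Complex.I))) 0 := by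
    refine hasRotationNumber_zero_of_mem_slitPlane ?_ (fun t => ?_) (by simp)
    · refine continuous_const.add (continuous_const.div (by fun_prop) fun t => ?_)
      exact mul_ne_zero hr' (Complex.exp_ne_zero _)
    · refine Complex.mem_slitPlane_of_norm_lt_one ?_
      rw [norm_div, norm_mul, norm_exp_two_pi_mul, mul_one, Complex.norm_real, Real.norm_eq_abs,
        abs_of_pos hr]
      exact (div_lt_one hr).2 h
  refine (h1.mul h2).congr fun t => ?_
  have := Complex.exp_ne_zero (2 * Real.pi * t * Complex.I)
  rw [circleLoop]
  field_simp
  ring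

theorem hasRotationNumber_circleLoop_sub_of_gt {a b : ℂ} {r : ℝ} (hr : 0 ≤ r) (h : r < ‖a - b‖) :
    HasRotationNumber (fun t => circleLoop a r t - b) 0 := by
  have hab : a - b ≠ 0 := norm_pos_iff.1 (hr.trans_lt h)
  have h2 : HasRotationNumber (fun t : ℝ => 1 + (circleLoop a r t - a) / (a - b)) 0 := by
    refine hasRotationNumber_zero_of_mem_slitPlane (by fun_prop) (fun t => ?_)
      (by rw [circleLoop_zero_eq_one])
    refine Complex.mem_slitPlane_of_norm_lt_one ?_
    rw [norm_div, norm_circleLoop_sub hr]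
    exact (div_lt_one (hr.trans_lt h)).2 h
  refine ((hasRotationNumber_const hab).mul h2).congr fun t => ?_
  field_simp
  ring

/-- A continuous loop of values along a simple closed curve is the restriction of a continuous
function on the plane, by the Tietze extension theorem. -/
theorem exists_continuous_extension_of_loop {c ℓ : ℝ → ℂ} (hc : Continuous c)
    (hinj : InjOn c (Ico 0 1)) (hc01 : c 0 = c 1) (hℓ : Continuous ℓ) (hℓ01 : ℓ 0 = ℓ 1) :
    ∃ G : ℂ → ℂ, Continuous G ∧ ∀ t ∈ Icc (0 : ℝ) 1, G (c t) = ℓ t := by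
  let p : Icc (0 : ℝ) 1 → c '' Icc 0 1 := fun t => ⟨c t, mem_image_of_mem c t.2⟩
  have hp : Continuous p := by fun_prop
  have hps : Function.Surjective p := by rintro ⟨_, t, ht, rfl⟩; exact ⟨⟨t, ht⟩, rfl⟩
  have hq : IsQuotientMap p := .of_surjective_continuous hps hp
  have hfac : Function.FactorsThrough (fun t : Icc (0 : ℝ) 1 => ℓ t) p := by
    -- moving the endpoint `1` to `0` reduces to the injectivity on `[0, 1)`
    have hred : ∀ t ∈ Icc (0 : ℝ) 1, ∃ t' ∈ Ico (0 : ℝ) 1, c t' = c t ∧ ℓ t' = ℓ t := by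
      intro t ht
      rcases ht.2.lt_or_eq with h | rfl
      · exact ⟨t, ⟨ht.1, h⟩, rfl, rfl⟩
      · exact ⟨0, by simp, hc01, hℓ01⟩
    rintro ⟨s, hs⟩ ⟨t, ht⟩ hst
    obtain ⟨s', hs', hcs, hls⟩ := hred s hs
    obtain ⟨t', ht', hct, hlt⟩ := hred t ht
    have h1 : c s = c t := congrArg Subtype.val hst
    have h2 : s' = t' := hinj hs' ht' (by rw [hcs, hct, h1])
    change ℓ s = ℓ t
    rw [← hls, ← hlt, h2]
  let g : C(c '' Icc 0 1, ℂ) :=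
    IsQuotientMap.lift (f := ⟨p, hp⟩) hq ⟨fun t : Icc (0 : ℝ) 1 => ℓ t, by fun_prop⟩ hfac
  obtain ⟨G, hG⟩ := ContinuousMap.exists_restrict_eq (isCompact_Icc.image hc).isClosed g
  refine ⟨G, G.continuous, fun t ht => ?_⟩
  have h1 : G (c t) = g (p ⟨t, ht⟩) := by rw [← hG]; rfl
  rw [h1]
  exact congrArg (fun φ : C(Icc (0 : ℝ) 1, ℂ) => φ ⟨t, ht⟩)
    (IsQuotientMap.lift_comp (f := ⟨p, hp⟩) hq ⟨fun t : Icc (0 : ℝ) 1 => ℓ t, by fun_prop⟩ hfac)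

/-! ### Isolated zeros and the degree formula in the plane -/

theorem hasIndex_iff {W : ℂ → ℂ} {z : ℂ} {m : ℤ} :
    HasIndex W z m ↔ ∀ᶠ r : ℝ in 𝓝[>] 0, HasRotationNumber (fun t => W (circleLoop z r t)) m :=
  Iff.rfl

/-- An isolated zero has an index: the rotation number along a small circle does not depend on the
radius, since the increment of a logarithm in polar coordinates is continuous in the radius. -/
theorem exists_hasIndex {W : ℂ → ℂ} {z : ℂ} {r₀ : ℝ} (hr₀ : 0 < r₀)
    (hW : ContinuousOn W (Metric.closedBall z r₀))
    (h0 : ∀ w ∈ Metric.closedBall z r₀, w ≠ z → W w ≠ 0) : ∃ m, HasIndex W z m := by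
  -- a parametrization of the radii in `(0, r₀]` by a simply connected space
  let φ : ℝ → ℝ := fun ρ => r₀ * Real.exp (-|ρ|)
  have hφ0 : ∀ ρ, 0 < φ ρ := fun ρ => mul_pos hr₀ (Real.exp_pos _)
  have hφ1 : ∀ ρ, φ ρ ≤ r₀ := fun ρ => by
    have : Real.exp (-|ρ|) ≤ 1 := Real.exp_le_one_iff.2 (by simp)
    exact mul_le_of_le_one_right hr₀.le this
  have hmem : ∀ q : ℝ × ℝ, circleLoop z (φ q.1) q.2 ∈ Metric.closedBall z r₀ := fun q => by
    rw [Metric.mem_closedBall, dist_eq_norm, norm_circleLoop_sub (hφ0 _).le]; exact hφ1 _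
  have hcont : Continuous fun q : ℝ × ℝ => circleLoop z (φ q.1) q.2 := by
    simp only [φ, circleLoop]; fun_prop
  obtain ⟨g, hg, hgW⟩ := exists_continuous_log
    (f := fun q : ℝ × ℝ => W (circleLoop z (φ q.1) q.2))
    (hW.comp_continuous hcont hmem) (fun q => h0 _ (hmem q) fun h => by
      have h1 := norm_circleLoop_sub (hφ0 q.1).le z q.2
      rw [h, sub_self, norm_zero] at h1
      exact (hφ0 q.1).ne h1)
  have hexp : ∀ ρ, Complex.exp (g (ρ, 1)) = Complex.exp (g (ρ, 0)) := fun ρ => by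
    rw [hgW, hgW]; simp only [circleLoop_zero_eq_one]
  obtain ⟨m, hm⟩ := exists_log_sub_eq (ℓ := fun t => g (0, t)) (hexp 0).symm
  refine ⟨m, ?_⟩
  rw [hasIndex_iff]
  filter_upwards [Ioc_mem_nhdsGT hr₀] with r hr
  have hφr : φ (Real.log (r₀ / r)) = r := by
    have : 0 ≤ Real.log (r₀ / r) := Real.log_nonneg ((one_le_div hr.1).2 hr.2)
    simp only [φ]
    rw [abs_of_nonneg this, Real.exp_neg, Real.exp_log (div_pos hr₀ hr.1)]
    field_simp
  refine hasRotationNumber_of_log (ℓ := fun t => g (Real.log (r₀ / r), t)) (by fun_prop)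
    (fun t => by rw [hgW]; simp only [hφr]) ?_
  rw [← hm]
  exact sub_eq_sub_of_exp_eq (u := fun ρ => g (ρ, 1)) (v := fun ρ => g (ρ, 0)) (by fun_prop)
    (by fun_prop) hexp _ _

theorem HasIndex.mul {F G : ℂ → ℂ} {z : ℂ} {m n : ℤ} (hF : HasIndex F z m) (hG : HasIndex G z n) :
    HasIndex (fun w => F w * G w) z (m + n) := by
  rw [hasIndex_iff] at *
  filter_upwards [hF, hG] with r h1 h2 using h1.mul h2

theorem HasIndex.congr_of_eventuallyEq {F G : ℂ → ℂ} {z : ℂ} {m : ℤ} (hF : HasIndex F z m)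
    (h : G =ᶠ[𝓝 z] F) : HasIndex G z m := by
  rw [hasIndex_iff] at *
  obtain ⟨ε, hε, hb⟩ := Metric.eventually_nhds_iff.1 h
  filter_upwards [hF, Ioo_mem_nhdsGT hε] with r h1 hr
  refine h1.congr fun t => hb ?_
  rw [dist_eq_norm, norm_circleLoop_sub hr.1.le]
  exact hr.2

theorem hasIndex_sub_zpow {a z : ℂ} (h : z ≠ a) (k : ℤ) :
    HasIndex (fun w => (w - a) ^ k) z 0 := by
  rw [hasIndex_iff]
  filter_upwards [Ioo_mem_nhdsGT (norm_pos_iff.2 (sub_ne_zero.2 h))] with r hr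
  simpa using (hasRotationNumber_circleLoop_sub_of_gt hr.1.le hr.2).zpow k

/-- A zero `a` of index `m` can be removed: away from a small disc around `a` divide by
`(z - a) ^ m`; the quotient has rotation number `0` along the circle bounding the disc and so
extends over the disc without zeros. -/
theorem HasIndex.exists_remove_zero {F : ℂ → ℂ} (hF : Continuous F) {a : ℂ} {m : ℤ}
    (hm : HasIndex F a m) {N : Set ℂ} (hN : N ∈ 𝓝 a) (h0 : ∀ z ∈ N, z ≠ a → F z ≠ 0) :
    ∃ r > 0, Metric.closedBall a r ⊆ N ∧ ∃ F' : ℂ → ℂ, Continuous F' ∧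
      (∀ z ∈ Metric.closedBall a r, F' z ≠ 0) ∧
      ∀ z ∉ Metric.closedBall a r, F' z = F z * (z - a) ^ (-m) := by
  obtain ⟨ε, hε, hεN⟩ := Metric.mem_nhds_iff.1 hN
  obtain ⟨r, hrm, hr⟩ := ((hasIndex_iff.1 hm).and (Ioo_mem_nhdsGT hε)).exists
  have hrN : Metric.closedBall a r ⊆ N := (Metric.closedBall_subset_ball hr.2).trans hεN
  have hca : ∀ t, circleLoop a r t - a ≠ 0 := fun t h => by
    have h1 := norm_circleLoop_sub hr.1.le a t
    rw [h, norm_zero] at h1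
    exact hr.1.ne h1
  have hcN : ∀ t, circleLoop a r t ∈ N := fun t => hrN <| by
    rw [Metric.mem_closedBall, dist_eq_norm, norm_circleLoop_sub hr.1.le]
  have hdiv : HasRotationNumber
      (fun t => F (circleLoop a r t) * (circleLoop a r t - a) ^ (-m)) 0 := by
    have h1 := (hasRotationNumber_circleLoop_sub_of_lt (a := a) (b := a) (by simpa using hr.1)).zpow
      (-m)
    simpa using hrm.mul h1
  have hcont : Continuous fun t => F (circleLoop a r t) * (circleLoop a r t - a) ^ (-m) :=
    (hF.comp (continuous_circleLoop a r)).mul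
      (((continuous_circleLoop a r).sub continuous_const).zpow₀ _ fun t => Or.inl (hca t))
  obtain ⟨ℓ, hℓ, hexp, hℓ01⟩ := hdiv.exists_log_loop hcont
    (fun t => mul_ne_zero (h0 _ (hcN t) (sub_ne_zero.1 (hca t))) (zpow_ne_zero _ (hca t)))
    (by rw [circleLoop_zero_eq_one])
  obtain ⟨G, hG, hGℓ⟩ := exists_continuous_extension_of_loop (continuous_circleLoop a r)
    (injOn_circleLoop a hr.1) (circleLoop_zero_eq_one a r) hℓ hℓ01
  classical
  refine ⟨r, hr.1, hrN, (Metric.closedBall a r).piecewise (fun z => Complex.exp (G z))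
    (fun z => F z * (z - a) ^ (-m)), ?_, fun z hz => ?_, fun z hz => ?_⟩
  · -- on the bounding circle the two definitions agree by the choice of `G`
    refine continuous_piecewise (fun z hz => ?_) (by fun_prop) ?_
    · rw [frontier_closedBall _ hr.1.ne', mem_sphere_iff_norm] at hz
      obtain ⟨t, ht, rfl⟩ := exists_circleLoop_eq hz
      rw [hGℓ t ht, hexp]
    · refine hF.continuousOn.mul (ContinuousOn.zpow₀ (by fun_prop) _ fun z hz => Or.inl ?_)
      rintro h
      rw [sub_eq_zero] at h
      subst h
      rw [closure_compl, interior_closedBall _ hr.1.ne'] at hz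
      exact hz (Metric.mem_ball_self hr.1)
  · rw [piecewise_eq_of_mem _ _ _ hz]; exact Complex.exp_ne_zero _
  · rw [piecewise_eq_of_notMem _ _ _ hz]

/-- The rotation number along a circle is the sum of the indices of the enclosed zeros. -/
theorem hasRotationNumber_circleLoop_eq_sum {R : ℝ} {m : ℂ → ℤ} (S : Finset ℂ) :
    ∀ {F : ℂ → ℂ}, Continuous F → (∀ z, F z = 0 ↔ z ∈ S) → (∀ z ∈ S, ‖z‖ < R) →
      (∀ z ∈ S, HasIndex F z (m z)) →
      HasRotationNumber (fun t => F (circleLoop 0 R t)) (∑ z ∈ S, m z) := by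
  classical
  induction S using Finset.induction_on with
  | empty =>
    intro F hF h0 _ _
    obtain ⟨g, hg, hgF⟩ := exists_continuous_log hF (fun z => by simp [h0])
    exact hasRotationNumber_of_log (ℓ := fun t => g (circleLoop 0 R t)) (by fun_prop)
      (fun t => hgF _) (by simp [circleLoop_zero_eq_one])
  | insert a S ha ih =>
    intro F hF h0 hR hm
    have hN : {z | ‖z‖ < R ∧ z ∉ S} ∈ 𝓝 a :=
      ((isOpen_lt continuous_norm continuous_const).inter S.isClosed.isOpen_compl).mem_nhds
        ⟨hR a (by simp), ha⟩
    obtain ⟨r, hr, hrN, F', hF', hF'0, hF'F⟩ := (hm a (by simp)).exists_remove_zero hF hN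
      (fun z hz hza => by simp [h0, hza, hz.2])
    have haF : ∀ z ∉ Metric.closedBall a r, z - a ≠ 0 := fun z hz h =>
      hz (by rw [sub_eq_zero.1 h]; exact Metric.mem_closedBall_self hr.le)
    have hF'S : ∀ z, F' z = 0 ↔ z ∈ S := by
      intro z
      by_cases hz : z ∈ Metric.closedBall a r
      · exact iff_of_false (hF'0 z hz) (hrN hz).2
      · have hza := haF z hz
        rw [hF'F z hz, mul_eq_zero, or_iff_left (zpow_ne_zero _ hza), h0, Finset.mem_insert,
          or_iff_right (sub_ne_zero.1 hza)]
    have hmS : ∀ z ∈ S, HasIndex F' z (m z) := by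
      intro z hz
      have hzb : z ∉ Metric.closedBall a r := fun h => (hrN h).2 hz
      have h1 := (hm z (by simp [hz])).mul
        (hasIndex_sub_zpow (sub_ne_zero.1 (haF z hzb)) (-m a))
      rw [add_zero] at h1
      refine h1.congr_of_eventuallyEq ?_
      filter_upwards [Metric.isClosed_closedBall.isOpen_compl.mem_nhds hzb] with w hw
      exact hF'F w hw
    have h1 := ih hF' hF'S (fun z hz => hR z (by simp [hz])) hmS
    have h2 := (hasRotationNumber_circleLoop_sub_of_lt (a := 0) (b := a) (r := R)
      (by simpa using hR a (by simp))).zpow (m a)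
    have hRpos : 0 ≤ R := (norm_nonneg a).trans (hR a (by simp)).le
    -- along the large circle `F` is `F' * (z - a) ^ m a`, and `z - a` makes one turn
    rw [Finset.sum_insert ha, add_comm]
    refine (mul_one (m a) ▸ h1.mul h2).congr fun t => ?_
    have hz : circleLoop 0 R t ∉ Metric.closedBall a r := fun h => by
      have h3 := (hrN h).1
      have h4 := norm_circleLoop_sub hRpos 0 t
      rw [sub_zero] at h4
      exact h3.ne h4
    rw [hF'F _ hz, mul_assoc, ← zpow_add₀ (haF _ hz)]
    simp

/-- Argument principle for a domain bounded by a simple closed curve `c`: if along `c` the function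
`f` turns as often as `(z - z₀) ^ N`, its zeros have total index `N`. The quotient of the two has a
logarithm on `c`, which extends to the plane; so `f` on `D` is continued outside `D` by a function
with no zeros that turns `N` times along large circles. -/
theorem sum_index_eq_of_hasRotationNumber {D : Set ℂ} (hD : IsCompact D) {c : ℝ → ℂ}
    (hc : Continuous c) (hper : Function.Periodic c 1) (hinj : InjOn c (Ico 0 1))
    (hrange : range c = frontier D) {z₀ : ℂ} (hz₀ : z₀ ∈ interior D) {f : ℂ → ℂ}
    (hf : ContinuousOn f D) {S : Finset ℂ} (hS : ∀ z, z ∈ S ↔ z ∈ interior D ∧ f z = 0)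
    (hfr : ∀ z ∈ frontier D, f z ≠ 0) {m : ℂ → ℤ} (hm : ∀ z ∈ S, HasIndex f z (m z)) {N : ℕ}
    (hrot : HasRotationNumber (fun t => f (c t) / (c t - z₀) ^ N) 0) :
    ∑ z ∈ S, m z = N := by
  classical
  have hfrD : frontier D ⊆ D := hD.isClosed.frontier_subset
  have hcfr : ∀ t, c t ∈ frontier D := fun t => hrange ▸ mem_range_self t
  have hcz : ∀ t, (c t - z₀) ^ N ≠ 0 := fun t => pow_ne_zero _ <| sub_ne_zero.2 fun h =>
    disjoint_interior_frontier.le_bot ⟨hz₀, h ▸ hcfr t⟩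
  have hc01 : c 0 = c 1 := by simpa using (hper 0).symm
  have hcont : Continuous fun t => f (c t) / (c t - z₀) ^ N :=
    (hf.comp_continuous hc fun t => hfrD (hcfr t)).div (by fun_prop) hcz
  obtain ⟨ℓ, hℓ, hexp, hℓ01⟩ := hrot.exists_log_loop hcont
    (fun t => div_ne_zero (hfr _ (hcfr t)) (hcz t)) (by rw [hc01])
  obtain ⟨G, hG, hGℓ⟩ := exists_continuous_extension_of_loop hc hinj hc01 hℓ hℓ01
  let F : ℂ → ℂ := D.piecewise f (fun z => Complex.exp (G z) * (z - z₀) ^ N)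
  have hFD : ∀ z ∈ D, F z = f z := fun z hz => piecewise_eq_of_mem _ _ _ hz
  have hFDc : ∀ z ∉ D, F z = Complex.exp (G z) * (z - z₀) ^ N := fun z hz =>
    piecewise_eq_of_notMem _ _ _ hz
  have hF : Continuous F := by
    refine continuous_piecewise (fun z hz => ?_) (by rwa [hD.isClosed.closure_eq]) (by fun_prop)
    obtain ⟨t, rfl⟩ := hrange.symm ▸ hz
    obtain ⟨t', ht', h⟩ := hper.exists_mem_Ico zero_lt_one t 0
    rw [zero_add] at ht'
    rw [h, hGℓ t' (Ico_subset_Icc_self ht'), hexp, div_mul_cancel₀ _ (hcz t')]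
  have hF0 : ∀ z, F z = 0 ↔ z ∈ S := by
    intro z
    by_cases hz : z ∈ D
    · rw [hFD z hz, hS, iff_and_self]
      intro h
      by_contra hint
      exact hfr z (by rw [hD.isClosed.frontier_eq]; exact ⟨hz, hint⟩) h
    · rw [hFDc z hz, hS]
      refine iff_of_false (mul_ne_zero (Complex.exp_ne_zero _) (pow_ne_zero _ ?_))
        fun h => hz (interior_subset h.1)
      exact sub_ne_zero.2 fun h => hz (h ▸ interior_subset hz₀)
  obtain ⟨R, hR⟩ := hD.isBounded.subset_ball (0 : ℂ)
  have hRD : ∀ z ∈ D, ‖z‖ < R := fun z hz => by simpa using hR hz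
  have hR0 : 0 ≤ R := (norm_nonneg _).trans (hRD z₀ (interior_subset hz₀)).le
  have h1 : HasRotationNumber (fun t => F (circleLoop 0 R t)) (∑ z ∈ S, m z) := by
    refine hasRotationNumber_circleLoop_eq_sum S hF hF0
      (fun z hz => hRD z (interior_subset ((hS z).1 hz).1))
      (fun z hz => (hm z hz).congr_of_eventuallyEq ?_)
    filter_upwards [mem_interior_iff_mem_nhds.1 ((hS z).1 hz).1] with w hw using hFD w hw
  have h2 : HasRotationNumber (fun t => F (circleLoop 0 R t)) N := by
    have h3 : HasRotationNumber (fun t => Complex.exp (G (circleLoop 0 R t))) 0 :=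
      hasRotationNumber_of_log (ℓ := fun t => G (circleLoop 0 R t)) (by fun_prop)
        (fun t => rfl) (by simp [circleLoop_zero_eq_one])
    have h4 := (hasRotationNumber_circleLoop_sub_of_lt (a := 0) (b := z₀) (r := R)
      (by simpa using hRD z₀ (interior_subset hz₀))).zpow N
    have h5 := h3.mul h4
    rw [zero_add, mul_one] at h5
    refine h5.congr fun t => ?_
    have hz : circleLoop 0 R t ∉ D := fun h => by
      have h6 := norm_circleLoop_sub hR0 0 t
      rw [sub_zero] at h6
      exact (hRD _ h).ne h6
    rw [hFDc _ hz, zpow_natCast]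
  exact h1.unique h2

/-! ### The boundary curve -/

theorem hasRotationNumber_zero_of_re_ne_zero {f : ℝ → ℂ} (hf : Continuous f)
    (h : ∀ t, (f t).re ≠ 0) (h01 : f 0 = f 1) : HasRotationNumber f 0 := by
  have hre : Continuous fun t => (f t).re := by fun_prop
  have hsign : (∀ t, 0 < (f t).re) ∨ ∀ t, 0 < (-f t).re := by
    by_contra! hcon
    obtain ⟨⟨t, ht⟩, ⟨u, hu⟩⟩ := hcon
    have hu' : 0 ≤ (f u).re := by simpa using hu
    obtain ⟨v, hv⟩ := mem_range_of_exists_le_of_exists_ge hre ⟨t, ht⟩ ⟨u, hu'⟩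
    exact h v hv
  rcases hsign with hs | hs
  · exact hasRotationNumber_zero_of_mem_slitPlane hf (fun t => Or.inl (hs t)) h01
  · refine ((hasRotationNumber_const (c := -1) (by simp)).mul
      (hasRotationNumber_zero_of_mem_slitPlane hf.neg (fun t => Or.inl (hs t))
        (congrArg Neg.neg h01))).congr fun t => ?_
    simp

/-- If two disjoint loops `c` and `q` are such that `q` stays strictly above `c 0`, then `c - q`
turns as often as `c` turns around `q 0`. A logarithm of `c t - q τ` on the `(t, τ)`-plane has the
same increment along the diagonal of the unit square as along two of its sides, and along the
side `t = 1` that increment vanishes because `c 1 - q τ` stays in the lower half plane. -/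
theorem hasRotationNumber_sub_div_sub {c q : ℝ → ℂ} (hc : Continuous c) (hq : Continuous q)
    (hc01 : c 0 = c 1) (hq01 : q 0 = q 1) (hne : ∀ t τ, c t ≠ q τ)
    (him : ∀ τ, (c 0).im < (q τ).im) :
    HasRotationNumber (fun t => (c t - q t) / (c t - q 0)) 0 := by
  obtain ⟨g, hg, hexp⟩ := exists_continuous_log (f := fun p : ℝ × ℝ => c p.1 - q p.2)
    (by fun_prop) (fun p => sub_ne_zero.2 (hne _ _))
  have hslit : ∀ τ, Complex.I * (c 1 - q τ) ∈ Complex.slitPlane := fun τ => Or.inl <| by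
    have := him τ
    rw [hc01] at this
    simpa using this
  have hside : g (1, 1) - g (1, 0) = 0 := by
    have h := sub_eq_sub_of_exp_eq (u := fun τ => g (1, τ))
      (v := fun τ => Complex.log (Complex.I * (c 1 - q τ)) - Complex.log Complex.I) (by fun_prop)
      ((Continuous.clog (by fun_prop) hslit).sub continuous_const)
      (fun τ => by
        rw [hexp, Complex.exp_sub, Complex.exp_log (Complex.slitPlane_ne_zero (hslit τ)),
          Complex.exp_log Complex.I_ne_zero, mul_div_cancel_left₀ _ Complex.I_ne_zero]) 1 0
    simp only [hq01] at h
    linear_combination h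
  refine hasRotationNumber_of_log (ℓ := fun t => g (t, t) - g (t, 0)) (by fun_prop)
    (fun t => by rw [Complex.exp_sub, hexp, hexp]) ?_
  simp [hside]

theorem periodic_deriv {γ : ℝ → ℂ} {L : ℝ} (h : Function.Periodic γ L) :
    Function.Periodic (deriv γ) L := fun t => by
  rw [← deriv_comp_add_const, show (fun x => γ (x + L)) = γ from funext h]

namespace IsSmoothDomain

variable {D : Set ℂ} {γ : ℝ → ℂ} {L : ℝ}

theorem hasDerivAt (hD : IsSmoothDomain D γ L) (t : ℝ) : HasDerivAt γ (deriv γ t) t :=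
  (hD.contDiff.differentiable (by simp) t).hasDerivAt

theorem continuous_deriv (hD : IsSmoothDomain D γ L) : Continuous (deriv γ) :=
  hD.contDiff.continuous_deriv (by simp)

theorem continuous_normal (hD : IsSmoothDomain D γ L) : Continuous (normal γ) :=
  continuous_const.mul hD.continuous_deriv

theorem periodic_normal (hD : IsSmoothDomain D γ L) : Function.Periodic (normal γ) L := fun t => by
  simp only [normal, periodic_deriv hD.periodic t]

theorem exists_int_of_eq (hD : IsSmoothDomain D γ L) {t u : ℝ} (h : γ u = γ t) :
    ∃ n : ℤ, u - t = n * L := by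
  obtain ⟨k, hk, -⟩ := existsUnique_add_zsmul_mem_Ico hD.length_pos t 0
  obtain ⟨j, hj, -⟩ := existsUnique_add_zsmul_mem_Ico hD.length_pos u 0
  rw [zero_add] at hk hj
  have heq := hD.injOn hj hk (by rw [hD.periodic.zsmul j u, hD.periodic.zsmul k t, h])
  refine ⟨k - j, ?_⟩
  simp only [zsmul_eq_mul] at heq
  push_cast
  linarith

theorem inner_deriv_normal (γ : ℝ → ℂ) (t s : ℝ) :
    inner ℝ (deriv γ t) (s * normal γ t) = 0 := by
  simp [Complex.inner, normal]; ring

/-- Short normal segments do not return to the curve: nearby points of the curve are excluded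
because there `⟪γ, γ' t⟫` is strictly monotone, distant ones because of their distance. -/
theorem exists_collar (hD : IsSmoothDomain D γ L) :
    ∃ ε : ℝ, 0 < ε ∧ ∀ t, ∀ s ∈ Ioo 0 ε, γ t + s * normal γ t ∉ range γ := by
  have hL := hD.length_pos
  have huc := isCompact_Icc.uniformContinuousOn_of_continuous
    (s := Icc (-L) (2 * L)) hD.continuous_deriv.continuousOn
  obtain ⟨δ, hδ, huc⟩ := Metric.uniformContinuousOn_iff.1 huc 1 one_pos
  have hnear : ∀ t ∈ Ico 0 L, ∀ u ∈ Icc (t - L / 2) (t + L / 2), |u - t| < δ →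
      inner ℝ (deriv γ t) (γ u - γ t) = 0 → u = t := by
    intro t ht u hu hut h0
    let J := Icc (t - L / 2) (t + L / 2) ∩ Ioo (t - δ) (t + δ)
    have hder : ∀ v, HasDerivAt (fun v => inner ℝ (deriv γ t) (γ v))
        (inner ℝ (deriv γ t) (deriv γ v)) v := fun v =>
      (innerSL ℝ (deriv γ t)).hasFDerivAt.comp_hasDerivAt v (hD.hasDerivAt v)
    have hmono : StrictMonoOn (fun v => inner ℝ (deriv γ t) (γ v)) J := by
      refine strictMonoOn_of_deriv_pos ((convex_Icc _ _).inter (convex_Ioo _ _))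
        (fun v _ => (hder v).continuousAt.continuousWithinAt) fun v hv => ?_
      obtain ⟨⟨h1, h2⟩, h3, h4⟩ := interior_subset hv
      rw [(hder v).deriv]
      have hd := huc t ⟨by linarith [ht.1], by linarith [ht.2]⟩ v
        ⟨by linarith [ht.1], by linarith [ht.2]⟩
        (by rw [Real.dist_eq, abs_lt]; constructor <;> linarith)
      rw [dist_eq_norm] at hd
      -- unit vectors at distance less than `1` have positive inner product
      have h5 := norm_sub_sq_real (deriv γ t) (deriv γ v)
      rw [hD.unit_speed, hD.unit_speed] at h5
      nlinarith [norm_nonneg (deriv γ t - deriv γ v)]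
    rw [abs_lt] at hut
    refine hmono.injOn ⟨hu, by constructor <;> linarith⟩
      ⟨by constructor <;> linarith, by constructor <;> linarith⟩ ?_
    rw [inner_sub_right, sub_eq_zero] at h0
    exact h0
  -- representatives of all pairs of parameters at distance at least `δ` modulo `L`
  let K : Set (ℝ × ℝ) :=
    Icc 0 L ×ˢ Icc (-L) (2 * L) ∩ {p | δ ≤ |p.2 - p.1| ∧ |p.2 - p.1| ≤ L / 2}
  have hK : IsCompact K := (isCompact_Icc.prod isCompact_Icc).inter_right
    <| by
    rw [ofPred_and]
    exact (isClosed_le (by fun_prop) (by fun_prop)).inter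
      (isClosed_le (by fun_prop) (by fun_prop))
  have hγ := hD.contDiff.continuous
  have hKpos : ∀ p ∈ K, 0 < ‖γ p.2 - γ p.1‖ := by
    rintro ⟨t, u⟩ ⟨-, h1, h2⟩
    rw [norm_pos_iff, sub_ne_zero]
    intro h
    obtain ⟨n, hn⟩ := hD.exists_int_of_eq h
    simp only at h1 h2
    rw [hn, abs_mul, abs_of_pos hL] at h1 h2
    have h4 : n = 0 := by
      have h3 : |(n : ℝ)| < 1 := by
        by_contra! h3
        nlinarith
      exact Int.abs_lt_one_iff.1 (by exact_mod_cast h3)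
    simp [h4] at h1
    linarith
  obtain ⟨ε, hε, hεK⟩ := hK.exists_forall_le' (by fun_prop) hKpos
  refine ⟨ε, hε, fun t s hs hmem => ?_⟩
  obtain ⟨t', ht', hγt⟩ : ∃ t' ∈ Ico 0 L, γ t + s * normal γ t = γ t' + s * normal γ t' := by
    obtain ⟨k, hk, -⟩ := existsUnique_add_zsmul_mem_Ico hL t 0
    rw [zero_add] at hk
    exact ⟨_, hk, by rw [hD.periodic.zsmul k t, hD.periodic_normal.zsmul k t]⟩
  rw [hγt] at hmem
  obtain ⟨u, hu⟩ := hmem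
  obtain ⟨u', hu', huu⟩ := hD.periodic.exists_mem_Ico hL u (t' - L / 2)
  have hsub : γ u' - γ t' = s * normal γ t' := by rw [← huu, hu]; ring
  have hu'' : |u' - t'| ≤ L / 2 := abs_le.2 ⟨by linarith [hu'.1], by linarith [hu'.2]⟩
  have hnorm : ‖γ u' - γ t'‖ = s := by
    simp [hsub, normal, hD.unit_speed, abs_of_pos hs.1]
  rcases lt_or_ge |u' - t'| δ with h | h
  · have := hnear t' ht' u' ⟨by linarith [hu'.1], by linarith [hu'.2]⟩ h
      (by rw [hsub, inner_deriv_normal])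
    rw [this, sub_self, norm_zero] at hnorm
    exact hs.1.ne hnorm
  · have := hεK (t', u') ⟨⟨Ico_subset_Icc_self ht', by linarith [hu'.1, ht'.1],
      by linarith [hu'.2, ht'.2]⟩, h, hu''⟩
    simp only at this
    linarith [hs.2]

/-- The curves parallel to the boundary on the inner side, close to it, lie in the interior. -/
theorem exists_parallel_mem_interior (hD : IsSmoothDomain D γ L) :
    ∃ s : ℝ, 0 < s ∧ ∀ t, γ t + s * normal γ t ∈ interior D := by
  obtain ⟨ε, hε, hcollar⟩ := hD.exists_collar
  obtain ⟨s, hs0, hs⟩ := ((hD.inward 0).and (Ioo_mem_nhdsGT hε)).exists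
  refine ⟨s, hs.1, ?_⟩
  have hcont : Continuous fun t => γ t + s * normal γ t :=
    hD.contDiff.continuous.add (continuous_const.mul hD.continuous_normal)
  -- the parallel curve avoids the frontier, so it cannot leave the interior
  have hD' : ∀ t, γ t + s * normal γ t ∈ D → γ t + s * normal γ t ∈ interior D := by
    intro t ht
    by_contra h
    refine hcollar t s hs ?_
    rw [hD.range_eq, hD.isCompact.isClosed.frontier_eq]
    exact ⟨ht, h⟩
  have hclopen : IsClopen {t | γ t + s * normal γ t ∈ interior D} := by
    refine ⟨?_, isOpen_interior.preimage hcont⟩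
    convert hD.isCompact.isClosed.preimage hcont using 1
    exact Subset.antisymm (fun _ ht => interior_subset (s := D) ht) (fun t ht => hD' t ht)
  exact eq_univ_iff_forall.1 (hclopen.eq_univ ⟨0, hs0⟩)

/-- A lowest point of the domain lies on the boundary, strictly below the interior. -/
theorem exists_lowest (hD : IsSmoothDomain D γ L) :
    ∃ t₀, ∀ z ∈ interior D, (γ t₀).im < z.im := by
  have hne : D.Nonempty := ⟨γ 0, hD.isCompact.isClosed.frontier_subset
    (hD.range_eq ▸ mem_range_self 0)⟩
  obtain ⟨p, hp, hmin⟩ := hD.isCompact.exists_isMinOn hne Complex.continuous_im.continuousOn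
  have hlt : ∀ z ∈ interior D, p.im < z.im := by
    intro z hz
    have hc : Tendsto (fun s : ℝ => z - s * Complex.I) (𝓝[>] 0) (𝓝 z) := by
      have : Continuous fun s : ℝ => z - s * Complex.I := by fun_prop
      simpa using (this.tendsto 0).mono_left nhdsWithin_le_nhds
    obtain ⟨s, hs, hs0⟩ :=
      ((hc.eventually (mem_interior_iff_mem_nhds.1 hz)).and self_mem_nhdsWithin).exists
    have h1 : p.im ≤ (z - s * Complex.I).im := hmin hs
    have hs0 : 0 < s := hs0
    simp at h1
    linarith
  have hpf : p ∈ frontier D := by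
    rw [hD.isCompact.isClosed.frontier_eq]
    exact ⟨hp, fun h => lt_irrefl _ (hlt p h)⟩
  obtain ⟨t₀, rfl⟩ := hD.range_eq.symm ▸ hpf
  exact ⟨t₀, hlt⟩

end IsSmoothDomain

/-! ### The Hessian along the boundary -/

section Hessian

variable {H : ℂ → ℝ} {U : Set ℂ}

theorem contDiffOn_fderiv (hU : IsOpen U) (hH : ContDiffOn ℝ ∞ H U) :
    ContDiffOn ℝ ∞ (fderiv ℝ H) U :=
  hH.fderiv_of_isOpen hU (by simp)

theorem differentiableAt_fderiv (hU : IsOpen U) (hH : ContDiffOn ℝ ∞ H U) {z : ℂ} (hz : z ∈ U) :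
    DifferentiableAt ℝ (fderiv ℝ H) z :=
  ((contDiffOn_fderiv hU hH).contDiffAt (hU.mem_nhds hz)).differentiableAt (by simp)

theorem differentiableAt_of_mem (hU : IsOpen U) (hH : ContDiffOn ℝ ∞ H U) {z : ℂ} (hz : z ∈ U) :
    DifferentiableAt ℝ H z :=
  (hH.contDiffAt (hU.mem_nhds hz)).differentiableAt (by simp)

theorem continuousOn_hessian (hU : IsOpen U) (hH : ContDiffOn ℝ ∞ H U) :
    ContinuousOn (fderiv ℝ (fderiv ℝ H)) U :=
  ((contDiffOn_fderiv hU hH).fderiv_of_isOpen (m := ∞) hU (by simp)).continuousOn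

theorem fderiv_fderiv_apply (hU : IsOpen U) (hH : ContDiffOn ℝ ∞ H U) {z : ℂ} (hz : z ∈ U)
    (v w : ℂ) : fderiv ℝ (fun x => fderiv ℝ H x v) z w = fderiv ℝ (fderiv ℝ H) z w v := by
  rw [fderiv_clm_apply (differentiableAt_fderiv hU hH hz) (differentiableAt_const v)]
  simp

theorem Hxx_eq (hU : IsOpen U) (hH : ContDiffOn ℝ ∞ H U) {z : ℂ} (hz : z ∈ U) :
    Hxx H z = fderiv ℝ (fderiv ℝ H) z 1 1 :=
  fderiv_fderiv_apply hU hH hz 1 1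

theorem Hxy_eq (hU : IsOpen U) (hH : ContDiffOn ℝ ∞ H U) {z : ℂ} (hz : z ∈ U) :
    Hxy H z = fderiv ℝ (fderiv ℝ H) z Complex.I 1 :=
  fderiv_fderiv_apply hU hH hz 1 Complex.I

theorem Hyy_eq (hU : IsOpen U) (hH : ContDiffOn ℝ ∞ H U) {z : ℂ} (hz : z ∈ U) :
    Hyy H z = fderiv ℝ (fderiv ℝ H) z Complex.I Complex.I :=
  fderiv_fderiv_apply hU hH hz Complex.I Complex.I

theorem hessian_symm (hU : IsOpen U) (hH : ContDiffOn ℝ ∞ H U) {z : ℂ} (hz : z ∈ U) (v w : ℂ) :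
    fderiv ℝ (fderiv ℝ H) z v w = fderiv ℝ (fderiv ℝ H) z w v :=
  ((hH.contDiffAt (hU.mem_nhds hz)).isSymmSndFDerivAt
    (by rw [minSmoothness_of_isRCLikeNormedField]; exact ENat.LEInfty.out)).eq v w

theorem V_eq_zero_iff {z : ℂ} : V H z = 0 ↔ IsSolution H z := by
  simp [V, IsSolution, Complex.ext_iff, sub_eq_zero, eq_comm]

theorem continuousOn_V (hU : IsOpen U) (hH : ContDiffOn ℝ ∞ H U) : ContinuousOn (V H) U := by
  have hB := continuousOn_hessian hU hH
  have h : ∀ v w : ℂ, ContinuousOn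
      (fun z => ((fderiv ℝ (fderiv ℝ H) z v w : ℝ) : ℂ)) U := fun v w =>
    Complex.continuous_ofReal.comp_continuousOn
      ((hB.clm_apply continuousOn_const).clm_apply continuousOn_const)
  refine (((h Complex.I Complex.I).sub (h 1 1)).sub
    ((continuousOn_const (c := 2 * Complex.I)).mul (h Complex.I 1))).congr fun z hz => ?_
  simp only [V, Hxx_eq hU hH hz, Hxy_eq hU hH hz, Hyy_eq hU hH hz]
  apply Complex.ext <;> simp

theorem hessian_apply (hU : IsOpen U) (hH : ContDiffOn ℝ ∞ H U) {z : ℂ} (hz : z ∈ U) (v w : ℂ) :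
    fderiv ℝ (fderiv ℝ H) z v w =
      v.re * w.re * Hxx H z + (v.re * w.im + v.im * w.re) * Hxy H z + v.im * w.im * Hyy H z := by
  have hdec : ∀ v : ℂ, v = v.re • (1 : ℂ) + v.im • Complex.I := fun v => by
    simpa [mul_comm] using (Complex.re_add_im v).symm
  have hs := hessian_symm hU hH hz 1 Complex.I
  rw [Hxx_eq hU hH hz, Hxy_eq hU hH hz, Hyy_eq hU hH hz]
  conv_lhs => rw [hdec v, hdec w]
  simp only [map_add, map_smul, add_apply, smul_apply,
    smul_eq_mul, hs]
  ring

/-- In a frame rotated by the unit vector `T`, the real part of `V` is again the difference of the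
two pure second derivatives. -/
theorem re_V_mul_conj_sq (hU : IsOpen U) (hH : ContDiffOn ℝ ∞ H U) {z : ℂ} (hz : z ∈ U) (T : ℂ) :
    (V H z * (starRingEnd ℂ T) ^ 2).re =
      fderiv ℝ (fderiv ℝ H) z (Complex.I * T) (Complex.I * T) - fderiv ℝ (fderiv ℝ H) z T T := by
  rw [hessian_apply hU hH hz, hessian_apply hU hH hz]
  simp [V, pow_two]
  ring

variable {γ : ℝ → ℂ}

theorem hasDerivAt_normal_line (γ : ℝ → ℂ) (t s : ℝ) :
    HasDerivAt (fun s : ℝ => γ t + s * normal γ t) (normal γ t) s := by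
  simpa using (Complex.ofRealCLM.hasDerivAt.mul_const (normal γ t)).const_add (γ t)

theorem hasDerivAt_alongNormal (hU : IsOpen U) (hH : ContDiffOn ℝ ∞ H U) {t s : ℝ}
    (hs : γ t + s * normal γ t ∈ U) :
    HasDerivAt (alongNormal H γ t)
      (fderiv ℝ H (γ t + s * normal γ t) (normal γ t)) s := by
  exact (differentiableAt_of_mem hU hH hs).hasFDerivAt.comp_hasDerivAt s
    (hasDerivAt_normal_line γ t s)

theorem Hs_eq (hU : IsOpen U) (hH : ContDiffOn ℝ ∞ H U) {t : ℝ} (ht : γ t ∈ U) :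
    Hs H γ t = fderiv ℝ H (γ t) (normal γ t) := by
  have h := hasDerivAt_alongNormal (γ := γ) (t := t) (s := 0) hU hH (by simpa using ht)
  rw [Hs, h.deriv]
  simp

theorem Hss_eq (hU : IsOpen U) (hH : ContDiffOn ℝ ∞ H U) {t : ℝ} (ht : γ t ∈ U) :
    Hss H γ t = fderiv ℝ (fderiv ℝ H) (γ t) (normal γ t) (normal γ t) := by
  have hc : Continuous fun s : ℝ => γ t + s * normal γ t := by fun_prop
  have hev : deriv (alongNormal H γ t) =ᶠ[𝓝 0]
      fun s : ℝ => fderiv ℝ H (γ t + s * normal γ t) (normal γ t) := by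
    filter_upwards [hc.continuousAt.preimage_mem_nhds (hU.mem_nhds (by simpa using ht))] with s hs
    exact (hasDerivAt_alongNormal hU hH hs).deriv
  have h2 : HasFDerivAt (fderiv ℝ H) (fderiv ℝ (fderiv ℝ H) (γ t))
      (γ t + ((0 : ℝ) : ℂ) * normal γ t) := by
    simpa using (differentiableAt_fderiv hU hH ht).hasFDerivAt
  have h3 : HasDerivAt (fun s : ℝ => fderiv ℝ H (γ t + s * normal γ t))
      (fderiv ℝ (fderiv ℝ H) (γ t) (normal γ t)) 0 :=
    h2.comp_hasDerivAt (0 : ℝ) (hasDerivAt_normal_line γ t 0)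
  have h4 := h3.clm_apply (hasDerivAt_const (0 : ℝ) (normal γ t))
  rw [Hss, iteratedDeriv_succ, iteratedDeriv_one, hev.deriv_eq, h4.deriv]
  simp

variable {D : Set ℂ} {L : ℝ}

theorem IsSmoothDomain.mem_frontier (hD : IsSmoothDomain D γ L) (t : ℝ) : γ t ∈ frontier D :=
  hD.range_eq ▸ mem_range_self t

theorem IsSmoothDomain.mem (hD : IsSmoothDomain D γ L) (t : ℝ) : γ t ∈ D :=
  hD.isCompact.isClosed.frontier_subset (hD.mem_frontier t)

theorem IsSmoothDomain.hasDerivAt_deriv (hD : IsSmoothDomain D γ L) (t : ℝ) :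
    HasDerivAt (deriv γ) (iteratedDeriv 2 γ t) t := by
  have h : ContDiff ℝ ∞ (deriv γ) := hD.contDiff.deriv'
  rw [iteratedDeriv_succ, iteratedDeriv_one]
  exact (h.differentiable (by simp) t).hasDerivAt

/-- The Frenet equation `γ'' = k n`. -/
theorem IsSmoothDomain.iteratedDeriv_two_eq (hD : IsSmoothDomain D γ L) (t : ℝ) :
    iteratedDeriv 2 γ t = curvature γ t * normal γ t := by
  have h1 : inner ℝ (deriv γ t) (iteratedDeriv 2 γ t) = 0 := by
    have h2 := (hD.hasDerivAt_deriv t).inner ℝ (hD.hasDerivAt_deriv t)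
    have h3 : (fun t => inner ℝ (deriv γ t) (deriv γ t)) = fun _ => (1 : ℝ) := by
      funext u; rw [real_inner_self_eq_norm_sq, hD.unit_speed]; norm_num
    rw [h3] at h2
    have h4 := h2.unique (hasDerivAt_const t (1 : ℝ))
    rw [real_inner_comm (deriv γ t) (iteratedDeriv 2 γ t)] at h4
    linarith
  have h5 : (deriv γ t).re ^ 2 + (deriv γ t).im ^ 2 = 1 := by
    have := Complex.sq_norm (deriv γ t)
    rw [hD.unit_speed, Complex.normSq_apply] at this
    linarith
  simp only [Complex.inner, Complex.mul_re, Complex.conj_re, Complex.conj_im] at h1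
  apply Complex.ext
  · simp [curvature, normal, Complex.inner]
    linear_combination (-(iteratedDeriv 2 γ t).re) * h5 + (deriv γ t).re * h1
  · simp [curvature, normal, Complex.inner]
    linear_combination (-(iteratedDeriv 2 γ t).im) * h5 + (deriv γ t).im * h1

theorem hasDerivAt_fderiv_comp (hD : IsSmoothDomain D γ L) (hU : IsOpen U) (hDU : D ⊆ U)
    (hH : ContDiffOn ℝ ∞ H U) (t : ℝ) :
    HasDerivAt (fun t => fderiv ℝ H (γ t)) (fderiv ℝ (fderiv ℝ H) (γ t) (deriv γ t)) t :=
  (differentiableAt_fderiv hU hH (hDU (hD.mem t))).hasFDerivAt.comp_hasDerivAt t (hD.hasDerivAt t)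

theorem fderiv_tangent_eq_zero (hD : IsSmoothDomain D γ L) (hU : IsOpen U) (hDU : D ⊆ U)
    (hH : ContDiffOn ℝ ∞ H U) {c : ℝ} (hc : ∀ z ∈ frontier D, H z = c) (t : ℝ) :
    fderiv ℝ H (γ t) (deriv γ t) = 0 := by
  have h1 := (differentiableAt_of_mem hU hH (hDU (hD.mem t))).hasFDerivAt.comp_hasDerivAt t
    (hD.hasDerivAt t)
  have h2 : H ∘ γ = fun _ => c := funext fun u => hc _ (hD.mem_frontier u)
  rw [h2] at h1
  exact h1.unique (hasDerivAt_const t c)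

theorem hessian_tangent (hD : IsSmoothDomain D γ L) (hU : IsOpen U) (hDU : D ⊆ U)
    (hH : ContDiffOn ℝ ∞ H U) {c : ℝ} (hc : ∀ z ∈ frontier D, H z = c) (t : ℝ) :
    fderiv ℝ (fderiv ℝ H) (γ t) (deriv γ t) (deriv γ t) = -(curvature γ t * Hs H γ t) := by
  have h1 := (hasDerivAt_fderiv_comp hD hU hDU hH t).clm_apply (hD.hasDerivAt_deriv t)
  have h2 : (fun t => fderiv ℝ H (γ t) (deriv γ t)) = fun _ => 0 :=
    funext (fderiv_tangent_eq_zero hD hU hDU hH hc)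
  rw [h2] at h1
  have h3 := h1.unique (hasDerivAt_const t (0 : ℝ))
  rw [hD.iteratedDeriv_two_eq, ← Complex.real_smul, map_smul, smul_eq_mul,
    ← Hs_eq hU hH (hDU (hD.mem t))] at h3
  linarith

/-- Along the boundary, `V` is `γ' ^ 2` times a function with real part `H_ss + k H_s`. -/
theorem re_V_mul_conj_deriv_sq (hD : IsSmoothDomain D γ L) (hU : IsOpen U) (hDU : D ⊆ U)
    (hH : ContDiffOn ℝ ∞ H U) {c : ℝ} (hc : ∀ z ∈ frontier D, H z = c) (t : ℝ) :
    (V H (γ t) * (starRingEnd ℂ (deriv γ t)) ^ 2).re =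
      Hss H γ t + curvature γ t * Hs H γ t := by
  rw [re_V_mul_conj_sq hU hH (hDU (hD.mem t)), hessian_tangent hD hU hDU hH hc,
    Hss_eq hU hH (hDU (hD.mem t)), normal]
  ring

theorem eq_zero_of_tangent_normal {E : Type*} [NormedAddCommGroup E] [NormedSpace ℝ E]
    (A : ℂ →L[ℝ] E) {T : ℂ} (hT : T ≠ 0) (h1 : A T = 0) (h2 : A (Complex.I * T) = 0) : A = 0 := by
  ext v
  have hv : v = (v / T).re • T + (v / T).im • (Complex.I * T) := by
    have h3 := Complex.re_add_im (v / T)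
    simp only [Complex.real_smul]
    rw [← mul_assoc, ← add_mul, h3, div_mul_cancel₀ _ hT]
  rw [hv, map_add, map_smul, map_smul, h1, h2]
  simp

/-- If the normal derivative vanishes, so does the gradient along the boundary; hence so does the
Hessian in the tangent direction, and `H_ss` is all that can be nonzero. -/
theorem Hss_ne_zero_of_Hs_eq_zero (hD : IsSmoothDomain D γ L) (hU : IsOpen U) (hDU : D ⊆ U)
    (hH : ContDiffOn ℝ ∞ H U) {c : ℝ} (hc : ∀ z ∈ frontier D, H z = c)
    (hs : ∀ t, Hs H γ t = 0) (hboundary : ∀ z ∈ frontier D, ¬ IsSolution H z) (t : ℝ) :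
    Hss H γ t ≠ 0 := by
  intro h0
  have hT : ∀ t, deriv γ t ≠ 0 := fun t h => by simpa [h] using hD.unit_speed t
  have hgrad : (fun t => fderiv ℝ H (γ t)) = fun _ => 0 := funext fun t =>
    eq_zero_of_tangent_normal _ (hT t) (fderiv_tangent_eq_zero hD hU hDU hH hc t)
      ((Hs_eq hU hH (hDU (hD.mem t))).symm.trans (hs t))
  have h1 := hasDerivAt_fderiv_comp hD hU hDU hH t
  rw [hgrad] at h1
  have h2 := h1.unique (hasDerivAt_const t 0)
  have hz := hDU (hD.mem t)
  have h3 : fderiv ℝ (fderiv ℝ H) (γ t) (normal γ t) = 0 := by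
    refine eq_zero_of_tangent_normal _ (hT t) ?_ ((Hss_eq hU hH hz).symm.trans h0)
    rw [hessian_symm hU hH hz, h2]
    rfl
  have h4 := eq_zero_of_tangent_normal (fderiv ℝ (fderiv ℝ H) (γ t)) (hT t) h2 h3
  refine hboundary _ (hD.mem_frontier t) ⟨?_, ?_⟩
  · rw [Hxx_eq hU hH hz, Hyy_eq hU hH hz, h4]; rfl
  · rw [Hxy_eq hU hH hz, h4]; rfl

end Hessian

/-! ### The count of solutions -/

/-- Isolated zeros in a compact set on which the field is continuous are finite in number. -/
theorem finite_zeros {D : Set ℂ} (hD : IsCompact D) {W : ℂ → ℂ} (hW : ContinuousOn W D)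
    (hiso : ∀ z ∈ D, W z = 0 → ∀ᶠ w in 𝓝[≠] z, ¬ (w ∈ D ∧ W w = 0)) :
    {z | z ∈ D ∧ W z = 0}.Finite := by
  by_contra hinf
  obtain ⟨x, hxD, hx⟩ := Set.Infinite.exists_accPt_of_subset_isCompact hinf hD fun z hz => hz.1
  have hcl : IsClosed {z | z ∈ D ∧ W z = 0} :=
    hW.preimage_isClosed_of_isClosed hD.isClosed isClosed_singleton
  have hx0 := hcl.closure_subset (mem_closure_iff_clusterPt.2 hx.clusterPt)
  exact (accPt_iff_frequently_nhdsNE.1 hx) (hiso x hxD hx0.2)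

/-- The tangent of the boundary turns as often as the boundary turns around some interior point
`z₀`. With `q` a parallel curve inside `D`, the tangent is a constant multiple of `γ - q`, and
starting at a lowest point of `D` the latter turns as often as `γ - q 0`. -/
theorem IsSmoothDomain.hasRotationNumber_deriv_div {D : Set ℂ} {γ : ℝ → ℂ} {L : ℝ}
    (hD : IsSmoothDomain D γ L) : ∃ t₀ : ℝ, ∃ z₀ ∈ interior D,
      HasRotationNumber (fun t => deriv γ (t₀ + L * t) / (γ (t₀ + L * t) - z₀)) 0 := by
  obtain ⟨s, hs, hq⟩ := hD.exists_parallel_mem_interior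
  obtain ⟨t₀, ht₀⟩ := hD.exists_lowest
  have h01 : t₀ + L * 1 = t₀ + L * 0 + L := by ring
  have hγ := hD.contDiff.continuous
  have hn := hD.continuous_normal
  have hrot := hasRotationNumber_sub_div_sub (c := fun t => γ (t₀ + L * t))
    (q := fun t => γ (t₀ + L * t) + s * normal γ (t₀ + L * t)) (by fun_prop) (by fun_prop)
    (by simp only [h01, hD.periodic _]) (by simp only [h01, hD.periodic _, hD.periodic_normal _])
    (fun t τ h => disjoint_interior_frontier.le_bot ⟨hq _, h ▸ hD.mem_frontier _⟩)
    (fun τ => by simpa using ht₀ _ (hq (t₀ + L * τ)))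
  refine ⟨t₀, _, hq (t₀ + L * 0), ?_⟩
  have hs' : (s : ℂ) ≠ 0 := by exact_mod_cast hs.ne'
  have hconst := hasRotationNumber_const (c := Complex.I / s) (div_ne_zero Complex.I_ne_zero hs')
  refine (zero_add (0 : ℤ) ▸ hconst.mul hrot).congr fun t => ?_
  rw [← mul_div_assoc]
  congr 1
  simp only [normal]
  field_simp
  linear_combination s * deriv γ (t₀ + L * t) * Complex.I_sq

end ConformalPoints

theorem mainTheorem1 (D : Set ℂ) (γ : ℝ → ℂ) (L : ℝ)
    (hD : ConformalPoints.IsSmoothDomain D γ L)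
    (H : ℂ → ℝ) (U : Set ℂ) (hU : IsOpen U) (hDU : D ⊆ U) (hH : ContDiffOn ℝ ∞ H U)
    (hconst : ∃ c : ℝ, ∀ z ∈ frontier D, H z = c)
    (hisolated : ∀ z ∈ D, ConformalPoints.IsSolution H z →
      ∀ᶠ w in 𝓝[≠] z, ¬ (w ∈ D ∧ ConformalPoints.IsSolution H w))
    (hboundary : ∀ z ∈ frontier D, ¬ ConformalPoints.IsSolution H z)
    (hcases : (∀ t, ConformalPoints.Hss H γ t
          + ConformalPoints.curvature γ t * ConformalPoints.Hs H γ t ≠ 0) ∨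
        (∀ t, ConformalPoints.Hs H γ t = 0)) :
    ∃ (S : Finset ℂ) (m : ℂ → ℤ),
      (∀ z, z ∈ S ↔ z ∈ interior D ∧ ConformalPoints.IsSolution H z) ∧
      (∀ z ∈ S, ConformalPoints.HasIndex (ConformalPoints.V H) z (m z)) ∧
      ∑ z ∈ S, m z = 2 := by
  open ConformalPoints in
  obtain ⟨k, hk⟩ := hconst
  simp only [← V_eq_zero_iff] at hisolated hboundary ⊢
  have hV : ContinuousOn (V H) D := (continuousOn_V hU hH).mono hDU
  -- the case of vanishing normal derivative is an instance of the other one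
  have hne : ∀ t, Hss H γ t + curvature γ t * Hs H γ t ≠ 0 := by
    rcases hcases with h | h
    · exact h
    · intro t
      rw [h t, mul_zero, add_zero]
      exact Hss_ne_zero_of_Hs_eq_zero hD hU hDU hH hk h
        (fun z hz => V_eq_zero_iff.not.1 (hboundary z hz)) t
  have hfin : {z | z ∈ interior D ∧ V H z = 0}.Finite :=
    (finite_zeros hD.isCompact hV hisolated).subset fun z hz => ⟨interior_subset hz.1, hz.2⟩
  have hS : ∀ z, z ∈ hfin.toFinset ↔ z ∈ interior D ∧ V H z = 0 := by simp
  have hidx : ∀ z, ∃ m : ℤ, z ∈ hfin.toFinset → HasIndex (V H) z m := by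
    intro z
    by_cases hz : z ∈ hfin.toFinset
    · obtain ⟨hzi, hz0⟩ := (hS z).1 hz
      have hev := hisolated z (interior_subset hzi) hz0
      rw [eventually_nhdsWithin_iff] at hev
      obtain ⟨r, hr, hb⟩ := Metric.nhds_basis_closedBall.mem_iff.1
        (hev.and (mem_interior_iff_mem_nhds.1 hzi))
      obtain ⟨m, hm⟩ := exists_hasIndex hr (hV.mono fun w hw => (hb hw).2)
        fun w hw hwz h0 => (hb hw).1 hwz ⟨(hb hw).2, h0⟩
      exact ⟨m, fun _ => hm⟩
    · exact ⟨0, fun h => absurd h hz⟩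
  choose m hm using hidx
  refine ⟨hfin.toFinset, m, hS, hm, ?_⟩
  obtain ⟨t₀, z₀, hz₀, hrot⟩ := hD.hasRotationNumber_deriv_div
  have hL := hD.length_pos
  have hγ := hD.contDiff.continuous
  have hT := hD.continuous_deriv
  have hper : Function.Periodic (fun t => γ (t₀ + L * t)) 1 := fun t => by
    simp only [mul_add, mul_one, ← add_assoc, hD.periodic _]
  have hVγ : Continuous fun t => V H (γ (t₀ + L * t)) :=
    hV.comp_continuous (by fun_prop) fun t => hD.mem _
  have h01 : t₀ + L * 1 = t₀ + L * 0 + L := by ring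
  refine sum_index_eq_of_hasRotationNumber hD.isCompact (c := fun t => γ (t₀ + L * t))
    (by fun_prop) hper ?_ ?_ hz₀ hV hS hboundary (fun z hz => hm z hz) (N := 2) ?_
  · intro t ht u hu htu
    obtain ⟨n, hn⟩ := hD.exists_int_of_eq htu
    have h1 : t - u = n := by
      apply mul_left_cancel₀ hL.ne'
      linarith
    have h2 : |(n : ℝ)| < 1 := by
      rw [← h1, abs_lt]
      constructor <;> linarith [ht.1, ht.2, hu.1, hu.2]
    have h3 : n = 0 := Int.abs_lt_one_iff.1 (by exact_mod_cast h2)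
    rw [h3, Int.cast_zero, sub_eq_zero] at h1
    exact h1
  · rw [← hD.range_eq]
    refine Subset.antisymm (range_subset_iff.2 fun t => mem_range_self _)
      (range_subset_iff.2 fun t => ⟨(t - t₀) / L, ?_⟩)
    simp only
    congr 1
    field_simp
    ring
  · -- along the boundary `V = h * γ' ^ 2`, where `h` has nonvanishing real part, and `γ'` turns
    -- as often as `γ - z₀`
    have hh : HasRotationNumber (fun t => V H (γ (t₀ + L * t)) *
        (starRingEnd ℂ (deriv γ (t₀ + L * t))) ^ 2) 0 := by
      refine hasRotationNumber_zero_of_re_ne_zero ?_ (fun t => ?_) ?_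
      · exact hVγ.mul ((Complex.continuous_conj.comp (by fun_prop)).pow 2)
      · rw [re_V_mul_conj_deriv_sq hD hU hDU hH hk]
        exact hne _
      · simp only [h01, hD.periodic _, periodic_deriv hD.periodic _]
    have h2 := hh.mul (hrot.zpow 2)
    rw [mul_zero, add_zero] at h2
    refine h2.congr fun t => ?_
    have hTT : starRingEnd ℂ (deriv γ (t₀ + L * t)) * deriv γ (t₀ + L * t) = 1 := by
      rw [mul_comm, Complex.mul_conj, Complex.normSq_eq_norm_sq, hD.unit_speed]
      norm_num
    rw [div_zpow, zpow_ofNat, zpow_ofNat, mul_div_assoc', mul_assoc, ← mul_pow, hTT, one_pow,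
      mul_one]
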